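/- Let $\mathcal C\subseteq\mathbb R^n$ be a polyhedral set (the solution set of finitely many non-strict linear inequalities) and let $f:\mathbb R^n\to\mathbb R$ be convex, twice continuously differentiable and bounded below, with constants $0<\mu_1\le\mu_2<\infty$ such that $\mu_1\|v\|_2^2\le v^T\nabla^2 f(x)\,v\le\mu_2\|v\|_2^2$ for all $x,v\in\mathbb R^n$. Notation. $\mathcal P$ is the orthogonal projection onto $\mathcal C$. For $x\in\mathcal C$, $\mathcal F(x)$ is the unique face of $\mathcal C$ (possibly $\mathcal C$ itself) whose relative interior contains $x$, and $\mathcal S(\mathcal F(x))=\{d\in\mathbb R^n:\ \exists\,\epsilon>0,\ \mathcal F(\mathcal P(x+\epsilon d))=\mathcal F(x)\}$ is its self-projection cone. For each face $\mathcal F$, $\Phi(\mathcal F)$ is a matrix whose columns are an arbitrary but fixed orthonormal basis of the linear span of $\mathcal F-\mathcal F$. Write $g_t=\nabla f(x_t)$ and $\mathcal F_t=\mathcal F(x_t)$. Parameters. Fix $0<\alpha_{\min}<\alpha_{\max}$, $\beta,\gamma\in(0,1)$, $0<\gamma_1<\tfrac12$, $\gamma_1<\gamma_2<1$, $h_0>0$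 and integers $M,N\ge1$. Algorithm. Start from $x_0\in\mathcal C$ with $H_0=\emptyset$ and any $\alpha_0\in[\alpha_{\min},\alpha_{\max}]$. For $t=0,1,2,\dots$: 1. (Quasi-Newton step.) If $H_t\ne\emptyset$, let $d_t=-\Phi_tH_t\Phi_t^Tg_t$ with $\Phi_t=\Phi(\mathcal F_t)$, and search for a step length $\eta\ge0$ with $x_t+\eta d_t\in\mathcal F_t$ that satisfies the Wolfe conditions $f(x_t+\eta d_t)\le f(x_t)+\gamma_1\eta\,g_t^Td_t$ and $\nabla f(x_t+\eta d_t)^Td_t\ge\gamma_2\,g_t^Td_t$. If the search succeeds, reset the history of objective values, so that it restarts with $f(x_{t+1})$, and put $x_{t+1}=x_t+\eta d_t$. The search may also fail or be abandoned. 2. (Projected-gradient step.) If no quasi-Newton step was taken, and $t>0$, let $s=x_t-x_{t-1}$, $y=g_t-g_{t-1}$ and set $\alpha_t=\max\{\min\{s^Ts/s^Ty,\alpha_{\max}\},\alpha_{\min}\}$ if $s^Ty>0$ and $\alpha_t=\alpha_{\max}$ otherwise. With $x(\alpha)=\mathcal P(x_t-\alpha g_t)$, put $x_{t+1}=x(\beta^k\alpha_t)$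 for the first integer $k\ge0$ such that $$f(x(\beta^k\alpha_t))\le\max_{0\le j\le\min\{t-r,\,M-1\}}f(x_{t-j})+\gamma\,g_t^T\bigl(x(\beta^k\alpha_t)-x_t\bigr),$$ where $r$ is the index of the first iterate in the history since its last reset ($r=0$ if there was none). 3. (Model update.) If $\mathcal F_{t+1}=\mathcal F_t$ and $-g_{t+1}\in\mathcal S(\mathcal F_{t+1})$, then $H_{t+1}$ is the L-BFGS update of $H_t$ with the pair $\Phi_{t+1}^T(x_{t+1}-x_t)$, $\Phi_{t+1}^T(g_{t+1}-g_t)$, that is, the matrix obtained from $h_0I$ by the BFGS inverse-Hessian updates with the at most $N$ most recent pairs collected since the model was last empty (a zero pair leaves the matrix unchanged). Otherwise $H_{t+1}=\emptyset$. Theorem. $f$ has a unique minimizer $x^*$ over $\mathcal C$, and every infinite sequence $\{x_t\}$ generated by this algorithm converges to $x^*$. -/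

import Mathlib

namespace HybridSPG

/-- Euclidean space `ℝⁿ`. -/
abbrev E (n : ℕ) : Type := EuclideanSpace ℝ (Fin n)

/-! ### Polyhedral sets, projections and faces -/

/-- A polyhedral set: the solution set of finitely many (non-strict) linear inequalities. -/
def IsPolyhedral {n : ℕ} (C : Set (E n)) : Prop :=
  ∃ (m : ℕ) (a : Fin m → E n) (b : Fin m → ℝ), C = {x | ∀ i, inner ℝ (a i) x ≤ b i}

/-- `z` is a closest point to `v` in `C`. -/
def IsProjection {n : ℕ} (C : Set (E n)) (v z : E n) : Prop :=
  z ∈ C ∧ IsMinOn (fun w => ‖w - v‖) C z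

open Classical in
/-- The orthogonal projection `P(v)` of `v` onto `C`, that is, the closest point to `v` in `C`
(for nonempty closed convex `C` it exists and is unique, see `existsUnique_isProjection`). -/
noncomputable def proj {n : ℕ} (C : Set (E n)) (v : E n) : E n :=
  Classical.epsilon (fun z => IsProjection C v z)

/-- The (nonempty) faces of `C`, including `C` itself: the sets of maximizers over `C` of a
linear functional. -/
def IsFace {n : ℕ} (C F : Set (E n)) : Prop :=
  F.Nonempty ∧ IsExposed ℝ C F

open Classical in
/-- `F(x)`: the face of `C` whose relative interior contains `x` (for a polyhedral set `C` and
`x ∈ C` it exists and is unique, see `existsUnique_face`). -/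
noncomputable def faceAt {n : ℕ} (C : Set (E n)) (x : E n) : Set (E n) :=
  Classical.epsilon (fun F => IsFace C F ∧ x ∈ intrinsicInterior ℝ F)

/-- The self-projection cone `S(F(x))` of the face `F(x)`: the directions `d` such that, for some
`ε > 0`, the projection of `x + ε d` onto `C` has the same face as `x`. -/
def selfProjCone {n : ℕ} (C : Set (E n)) (x : E n) : Set (E n) :=
  {d | ∃ ε : ℝ, 0 < ε ∧ faceAt C (proj C (x + ε • d)) = faceAt C x}

/-! ### Well-definedness of the projection and of `F(x)` -/

theorem IsPolyhedral.isClosed {n : ℕ} {C : Set (E n)} (hC : IsPolyhedral C) : IsClosed C := by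
  obtain ⟨m, a, b, rfl⟩ := hC
  simp only [Set.ofPred_forall]
  exact isClosed_iInter fun i => isClosed_le (by fun_prop) continuous_const

theorem IsPolyhedral.convex {n : ℕ} {C : Set (E n)} (hC : IsPolyhedral C) : Convex ℝ C := by
  obtain ⟨m, a, b, rfl⟩ := hC
  simp only [Set.ofPred_forall]
  exact convex_iInter fun i => convex_halfSpace_le (innerSL ℝ (a i)).toLinearMap.isLinear (b i)

theorem existsUnique_isProjection {n : ℕ} {C : Set (E n)} (hcl : IsClosed C) (hcv : Convex ℝ C)
    (hne : C.Nonempty) (v : E n) : ∃! z, IsProjection C v z := by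
  have key : ∀ z ∈ C, (IsProjection C v z ↔ ∀ w ∈ C, inner ℝ (v - z) (w - z) ≤ 0) := by
    intro z hz
    rw [← norm_eq_iInf_iff_real_inner_le_zero hcv hz]
    have : Nonempty C := ⟨⟨z, hz⟩⟩
    have hb : BddBelow (Set.range fun w : C => ‖v - w‖) :=
      ⟨0, by rintro _ ⟨w, rfl⟩; exact norm_nonneg _⟩
    constructor
    · rintro ⟨_, h⟩
      refine le_antisymm (le_ciInf fun w => ?_) (ciInf_le hb (⟨z, hz⟩ : C))
      have := h w.2
      simp only [Set.mem_ofPred_eq] at this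
      rwa [norm_sub_rev v z, norm_sub_rev v w]
    · intro h
      refine ⟨hz, fun w hw => ?_⟩
      have := ciInf_le hb (⟨w, hw⟩ : C)
      simp only [Set.mem_ofPred_eq]
      rw [norm_sub_rev z v, norm_sub_rev w v, h]
      exact this
  obtain ⟨z, hz, hmin⟩ := exists_norm_eq_iInf_of_complete_convex hne hcl.isComplete hcv v
  refine ⟨z, (key z hz).2 ((norm_eq_iInf_iff_real_inner_le_zero hcv hz).1 hmin), ?_⟩
  intro z' h'
  have h1 := (norm_eq_iInf_iff_real_inner_le_zero hcv hz).1 hmin z' h'.1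
  have h2 := (key z' h'.1).1 h' z hz
  have h3 : inner ℝ (z' - z) (z' - z) ≤ 0 := by
    have e : inner ℝ (z' - z) (z' - z)
        = inner ℝ (v - z) (z' - z) + inner ℝ (v - z') (z - z') := by
      have : z - z' = -(z' - z) := by abel
      rw [this, inner_neg_right, ← sub_eq_add_neg, ← inner_sub_left]
      congr 1
      abel
    rw [e]; linarith
  exact sub_eq_zero.1 (inner_self_eq_zero.1 (le_antisymm h3 real_inner_self_nonneg))

theorem proj_spec {n : ℕ} {C : Set (E n)} (hC : IsPolyhedral C) (hne : C.Nonempty) (v : E n) :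
    IsProjection C v (proj C v) :=
  Classical.epsilon_spec (existsUnique_isProjection hC.isClosed hC.convex hne v).exists

theorem face_subset_of_mem {n : ℕ} {C F G : Set (E n)} (hF : IsFace C F)
    (hG : IsFace C G) {x : E n} (hxF : x ∈ intrinsicInterior ℝ F) (hxG : x ∈ G) : F ⊆ G := by
  intro y hy
  obtain ⟨x', hx', rfl⟩ := hxF
  have hyA : y ∈ affineSpan ℝ F := subset_affineSpan ℝ F hy
  let φ : ℝ → affineSpan ℝ F := fun t =>
    ⟨AffineMap.lineMap (x' : E n) y t, AffineMap.lineMap_mem t x'.2 hyA⟩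
  have hφ : Continuous φ := Continuous.subtype_mk AffineMap.lineMap_continuous _
  have h0 : φ 0 = x' := Subtype.ext (AffineMap.lineMap_apply_zero _ _)
  have hn : φ ⁻¹' interior ((↑) ⁻¹' F : Set (affineSpan ℝ F)) ∈ nhds (0 : ℝ) :=
    (isOpen_interior.preimage hφ).mem_nhds (by simpa [h0] using hx')
  obtain ⟨ε, hε, hball⟩ := Metric.mem_nhds_iff.1 hn
  have hz : φ (-(ε / 2)) ∈ interior ((↑) ⁻¹' F : Set (affineSpan ℝ F)) := by
    apply hball
    simp only [Metric.mem_ball, dist_zero_right, norm_neg, Real.norm_eq_abs]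
    rw [abs_of_pos (by positivity)]
    linarith
  have hzF : AffineMap.lineMap (x' : E n) y (-(ε / 2)) ∈ F :=
    (interior_subset hz : φ (-(ε / 2)) ∈ ((↑) ⁻¹' F : Set (affineSpan ℝ F)))
  refine (hG.2.isExtreme).left_mem_of_mem_openSegment (hF.2.subset hy) (hF.2.subset hzF) hxG ?_
  have hpos : 0 < 1 + ε / 2 := by positivity
  refine ⟨(ε / 2) / (1 + ε / 2), 1 / (1 + ε / 2), by positivity, by positivity, ?_, ?_⟩
  · field_simp
    ring
  · rw [AffineMap.lineMap_apply_module]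
    rw [smul_add, smul_smul, smul_smul, add_comm, add_assoc, ← add_smul]
    have e1 : 1 / (1 + ε / 2) * (1 - -(ε / 2)) = 1 := by field_simp; ring
    have e2 : 1 / (1 + ε / 2) * -(ε / 2) + ε / 2 / (1 + ε / 2) = 0 := by field_simp; ring
    rw [e1, e2]
    simp

theorem existsUnique_face {n : ℕ} {C : Set (E n)} (hC : IsPolyhedral C) {x : E n} (hx : x ∈ C) :
    ∃! F, IsFace C F ∧ x ∈ intrinsicInterior ℝ F := by
  classical
  refine existsUnique_of_exists_of_unique ?_ ?_
  · obtain ⟨m, a, b, rfl⟩ := hC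
    set C : Set (E n) := {x | ∀ i, inner ℝ (a i) x ≤ b i} with hCdef
    let A : Finset (Fin m) := Finset.univ.filter fun i => inner ℝ (a i) x = b i
    let F : Set (E n) := {y | y ∈ C ∧ ∀ i ∈ A, inner ℝ (a i) y = b i}
    have hA : ∀ i ∈ A, inner ℝ (a i) x = b i := fun i hi => (Finset.mem_filter.1 hi).2
    have hxF : x ∈ F := ⟨hx, hA⟩
    refine ⟨F, ⟨⟨x, hxF⟩, fun _ => ⟨∑ i ∈ A, innerSL ℝ (a i), ?_⟩⟩, ?_⟩
    · ext y
      simp only [_root_.sum_apply, innerSL_apply_apply, Set.mem_ofPred_eq, F]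
      refine and_congr_right fun hy => ⟨fun h w hw => ?_, fun h => ?_⟩
      · rw [Finset.sum_congr rfl h]
        exact Finset.sum_le_sum fun i _ => hw i
      · have h1 := h x hx
        rw [Finset.sum_congr rfl hA] at h1
        exact (Finset.sum_eq_sum_iff_of_le fun i _ => hy i).1
          (le_antisymm (Finset.sum_le_sum fun i _ => hy i) h1)
    · have hspan : ∀ z ∈ affineSpan ℝ F, ∀ i ∈ A, inner ℝ (a i) z = b i := by
        intro z hz i hi
        refine affineSpan_induction (p := fun z => inner ℝ (a i) z = b i) hz
          (fun y hy => hy.2 i hi) ?_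
        intro c u v w hu hv hw
        simp only [vsub_eq_sub, vadd_eq_add, inner_add_right, inner_smul_right, inner_sub_right]
        rw [hu, hv, hw]
        ring
      refine ⟨⟨x, subset_affineSpan ℝ F hxF⟩, ?_, rfl⟩
      rw [mem_interior]
      refine ⟨{z | ∀ i : Fin m, i ∉ A → inner ℝ (a i) (z : E n) < b i}, ?_, ?_, ?_⟩
      · intro z hz
        have hzA := hspan z z.2
        refine ⟨fun i => ?_, hzA⟩
        by_cases hi : i ∈ A
        · exact (hzA i hi).le
        · exact (hz i hi).le
      · simp only [Set.ofPred_forall]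
        exact isOpen_iInter_of_finite fun i => isOpen_iInter_of_finite fun _ =>
          isOpen_lt (by fun_prop) continuous_const
      · intro i hi
        refine lt_of_le_of_ne (hx i) fun h => hi ?_
        simp [A, h]
  · rintro F G ⟨hF, hxF⟩ ⟨hG, hxG⟩
    exact Set.Subset.antisymm
      (face_subset_of_mem hF hG hxF (intrinsicInterior_subset hxG))
      (face_subset_of_mem hG hF hxG (intrinsicInterior_subset hxF))

theorem faceAt_spec {n : ℕ} {C : Set (E n)} (hC : IsPolyhedral C) {x : E n} (hx : x ∈ C) :
    IsFace C (faceAt C x) ∧ x ∈ intrinsicInterior ℝ (faceAt C x) :=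
  Classical.epsilon_spec (existsUnique_face hC hx).exists

/-! ### The standing assumptions on the objective -/

/-- `f` is convex, twice continuously differentiable and bounded below, and its Hessian `H(x)`
satisfies `μ₁ ‖v‖² ≤ vᵀ H(x) v ≤ μ₂ ‖v‖²` for all `x` and `v`, with constants
`0 < μ₁ ≤ μ₂ < ∞`. -/
structure Assumptions {n : ℕ} (f : E n → ℝ) : Prop where
  convex : ConvexOn ℝ Set.univ f
  contDiff : ContDiff ℝ 2 f
  bddBelow : BddBelow (Set.range f)
  hessian : ∃ μ₁ μ₂ : ℝ, 0 < μ₁ ∧ μ₁ ≤ μ₂ ∧ ∀ x v : E n,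
    μ₁ * ‖v‖ ^ 2 ≤ fderiv ℝ (fderiv ℝ f) x v v ∧ fderiv ℝ (fderiv ℝ f) x v v ≤ μ₂ * ‖v‖ ^ 2

/-! ### The L-BFGS matrices on a face -/

/-- A choice, for every set `F`, of an orthonormal basis of the difference hull of `F`
(the linear span of all differences of points of `F`). -/
abbrev FaceBasis (n : ℕ) : Type :=
  ∀ F : Set (E n), OrthonormalBasis (Fin (Module.finrank ℝ (vectorSpan ℝ F))) ℝ (vectorSpan ℝ F)

/-- The `n × k` matrix `Φ(F)` whose columns are the chosen orthonormal basis vectors of the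
difference hull of `F`. -/
noncomputable def basisMatrix {n : ℕ} (Φ : FaceBasis n) (F : Set (E n)) :
    Matrix (Fin n) (Fin (Module.finrank ℝ (vectorSpan ℝ F))) ℝ :=
  Matrix.of fun i j => (Φ F j : E n) i

/-- The BFGS update of an inverse-Hessian approximation `H` with the pair `(s, y)`:
`Vᵀ H V + ρ s sᵀ` with `ρ = 1 / (yᵀ s)` and `V = I - ρ y sᵀ`.
(For `s = y = 0` the update leaves `H` unchanged.) -/
noncomputable def bfgsUpdate {k : ℕ} (H : Matrix (Fin k) (Fin k) ℝ) (s y : Fin k → ℝ) :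
    Matrix (Fin k) (Fin k) ℝ :=
  let ρ : ℝ := (y ⬝ᵥ s)⁻¹
  let V : Matrix (Fin k) (Fin k) ℝ := 1 - ρ • Matrix.vecMulVec y s
  V.transpose * H * V + ρ • Matrix.vecMulVec s s

/-- The limited-memory matrix: start from `h₀ I` and apply the BFGS updates with the stored pairs,
the list being ordered from the most recent pair to the oldest one. -/
noncomputable def lbfgsMatrix {k : ℕ} (h₀ : ℝ) :
    List ((Fin k → ℝ) × (Fin k → ℝ)) → Matrix (Fin k) (Fin k) ℝ
  | [] => h₀ • (1 : Matrix (Fin k) (Fin k) ℝ)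
  | p :: ps => bfgsUpdate (lbfgsMatrix h₀ ps) p.1 p.2

/-- The matrix `H` on the face `F` obtained from a list of pairs
`(x_i - x_{i-1}, g_i - g_{i-1})` (most recent first), each of which is mapped to face coordinates
by `Φ(F)ᵀ`. -/
noncomputable def faceMatrix {n : ℕ} (Φ : FaceBasis n) (h₀ : ℝ) (F : Set (E n))
    (pairs : List (E n × E n)) :
    Matrix (Fin (Module.finrank ℝ (vectorSpan ℝ F)))
      (Fin (Module.finrank ℝ (vectorSpan ℝ F))) ℝ :=
  lbfgsMatrix h₀ (pairs.map fun p =>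
    ((basisMatrix Φ F).transpose.mulVec (WithLp.ofLp p.1),
      (basisMatrix Φ F).transpose.mulVec (WithLp.ofLp p.2)))

/-- The quasi-Newton direction `d = -Φ H Φᵀ g`. -/
noncomputable def qnDirection {n : ℕ} (Φ : FaceBasis n) (h₀ : ℝ) (F : Set (E n))
    (pairs : List (E n × E n)) (g : E n) : E n :=
  -WithLp.toLp 2 ((basisMatrix Φ F * faceMatrix Φ h₀ F pairs *
    (basisMatrix Φ F).transpose).mulVec (WithLp.ofLp g))

/-! ### The hybrid algorithm -/

/-- The parameters of the algorithm. -/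
structure Params where
  /-- lower safeguard on the spectral step length -/
  αmin : ℝ
  /-- upper safeguard on the spectral step length -/
  αmax : ℝ
  /-- backtracking factor of the projected-gradient line search -/
  β : ℝ
  /-- sufficient-decrease parameter of the projected-gradient line search -/
  γ : ℝ
  /-- number of objective values kept for the nonmonotone line search -/
  M : ℕ
  /-- sufficient-decrease parameter of the Wolfe conditions -/
  γ₁ : ℝ
  /-- curvature parameter of the Wolfe conditions -/
  γ₂ : ℝ
  /-- scaling of the initial inverse-Hessian approximation -/
  h₀ : ℝ
  /-- number of pairs kept for the L-BFGS update -/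
  N : ℕ
  αmin_pos : 0 < αmin
  αmin_lt_αmax : αmin < αmax
  β_mem : β ∈ Set.Ioo (0 : ℝ) 1
  γ_mem : γ ∈ Set.Ioo (0 : ℝ) 1
  one_le_M : 1 ≤ M
  γ₁_pos : 0 < γ₁
  γ₁_lt_half : γ₁ < 1 / 2
  γ₁_lt_γ₂ : γ₁ < γ₂
  γ₂_lt_one : γ₂ < 1
  h₀_pos : 0 < h₀
  one_le_N : 1 ≤ N

/-- The initial step length of the projected-gradient line search at iteration `t`: the value `α₀`
at `t = 0`, and the safeguarded Barzilai-Borwein step length afterwards. -/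
noncomputable def bbStep {n : ℕ} (P : Params) (f : E n → ℝ) (α₀ : ℝ) (x : ℕ → E n) : ℕ → ℝ
  | 0 => α₀
  | t + 1 =>
    let s := x (t + 1) - x t
    let y := gradient f (x (t + 1)) - gradient f (x t)
    if 0 < inner ℝ s y then max (min (inner ℝ s s / inner ℝ s y) P.αmax) P.αmin else P.αmax

open Classical in
/-- The index of the oldest iterate in the objective-value history at iteration `t`: the history
is reset at each (successful) quasi-Newton step, where `qn t` says that step `t`, from `x t` to
`x (t + 1)`, is a quasi-Newton step. -/
noncomputable def historyStart (qn : ℕ → Prop) : ℕ → ℕ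
  | 0 => 0
  | t + 1 => if qn t then t + 1 else historyStart qn t

/-- The maximum of the (at most `M`) most recent objective values since the last reset. -/
noncomputable def historyMax {n : ℕ} (P : Params) (f : E n → ℝ) (x : ℕ → E n)
    (qn : ℕ → Prop) (t : ℕ) : ℝ :=
  (Finset.range (min (t - historyStart qn t) (P.M - 1) + 1)).sup' Finset.nonempty_range_add_one
    (fun j => f (x (t - j)))

open Classical in
/-- The quadratic model `H_t`: `none` stands for `H_t = ∅`; otherwise the list of pairs
(most recent first, at most `N`) which determines `H_t` as the L-BFGS matrix on `F(x_t)`. -/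
noncomputable def model {n : ℕ} (P : Params) (f : E n → ℝ) (C : Set (E n)) (x : ℕ → E n) :
    ℕ → Option (List (E n × E n))
  | 0 => none
  | t + 1 =>
    if faceAt C (x (t + 1)) = faceAt C (x t) ∧
        -gradient f (x (t + 1)) ∈ selfProjCone C (x (t + 1)) then
      some (((x (t + 1) - x t, gradient f (x (t + 1)) - gradient f (x t)) ::
        (model P f C x t).getD []).take P.N)
    else none

/-- A quasi-Newton step at iteration `t`: a model `H_t ≠ ∅` is available, and the line search
along `x_t + η d_t`, restricted to the current face, has found a step length `η ≥ 0` that satisfies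
the two Wolfe conditions. -/
def IsQNStep {n : ℕ} (P : Params) (Φ : FaceBasis n) (f : E n → ℝ) (C : Set (E n))
    (x : ℕ → E n) (t : ℕ) : Prop :=
  ∃ pairs, model P f C x t = some pairs ∧ ∃ η : ℝ, 0 ≤ η ∧
    let g := gradient f (x t)
    let d := qnDirection Φ P.h₀ (faceAt C (x t)) pairs g
    x t + η • d ∈ faceAt C (x t) ∧
    f (x t + η • d) ≤ f (x t) + P.γ₁ * η * inner ℝ g d ∧
    P.γ₂ * inner ℝ g d ≤ inner ℝ (gradient f (x t + η • d)) d ∧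
    x (t + 1) = x t + η • d

/-- The nonmonotone Armijo condition for the trial point `x(α) = P(x_t - α ∇f(x_t))`. -/
def Armijo {n : ℕ} (P : Params) (f : E n → ℝ) (C : Set (E n)) (x : ℕ → E n)
    (qn : ℕ → Prop) (t : ℕ) (α : ℝ) : Prop :=
  let z := proj C (x t - α • gradient f (x t))
  f z ≤ historyMax P f x qn t + P.γ * inner ℝ (gradient f (x t)) (z - x t)

/-- A spectral projected-gradient step at iteration `t`: the step length is `β ^ k` times the
initial one, with `k` the first nonnegative integer for which the Armijo condition holds. -/
def IsSPGStep {n : ℕ} (P : Params) (f : E n → ℝ) (C : Set (E n)) (α₀ : ℝ) (x : ℕ → E n)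
    (qn : ℕ → Prop) (t : ℕ) : Prop :=
  ∃ k : ℕ, Armijo P f C x qn t (P.β ^ k * bbStep P f α₀ x t) ∧
    (∀ j < k, ¬ Armijo P f C x qn t (P.β ^ j * bbStep P f α₀ x t)) ∧
    x (t + 1) = proj C (x t - (P.β ^ k * bbStep P f α₀ x t) • gradient f (x t))

/-- The infinite sequence `x` is generated by the hybrid algorithm started at `x₀`. At each
iteration either a quasi-Newton step on the current face is taken (`qn t`), or, when no model is
available or the Wolfe line search fails or is abandoned, a spectral projected-gradient step. -/
def IsGenerated {n : ℕ} (P : Params) (Φ : FaceBasis n) (f : E n → ℝ) (C : Set (E n))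
    (x₀ : E n) (x : ℕ → E n) : Prop :=
  ∃ (α₀ : ℝ) (qn : ℕ → Prop), α₀ ∈ Set.Icc P.αmin P.αmax ∧ x 0 = x₀ ∧
    ∀ t, (qn t → IsQNStep P Φ f C x t) ∧ (¬ qn t → IsSPGStep P f C α₀ x qn t)

end HybridSPG

/-! The Hessian bounds make `f` strongly convex with Lipschitz gradient, so a minimizer `x*` over
`C` exists, and quadratic growth around it gives uniqueness and turns `f (x t) → f x*` into `x t →
x*`. For the values, both kinds of step contract the gap: `f (x (t+1)) - f x* ≤ q (W t - f x*)`,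
with `W` the history maximum and `q < 1` independent of `t`. Quasi-Newton steps
(`exists_qn_contraction`): the self-projection condition lets the gradient projected onto the face
control the whole gap (`inner_faceVec_le_of_neg_mem_selfProjCone`), while the Wolfe conditions and
uniformly bounded L-BFGS matrices (`exists_matrixBounds_lbfgsMatrix`) give a decrease proportional
to its squared norm. Projected-gradient steps (`exists_spg_contraction`): backtracking keeps the
step length bounded below, so `‖x (t+1) - x t‖²` controls both the decrease below `W t` and the new
gap. `W` is nonincreasing and its gap shrinks by `q` every `M` iterations
(`tendsto_of_historyMax_contraction`). Neither identification of the optimal face nor the pattern of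
steps matters. -/

namespace HybridSPG

/-! ### Strong convexity, smoothness and quadratic growth. -/

/-- `f` has gradient `G` and satisfies quadratic lower and upper bounds with constants `μ` and `L`,
and `G` is `L`-Lipschitz. -/
structure QuadraticBounds {n : ℕ} (f : E n → ℝ) (G : E n → E n) (μ L : ℝ) : Prop where
  pos : 0 < μ
  le : μ ≤ L
  cont : Continuous f
  lower : ∀ x y, f x + inner ℝ (G x) (y - x) + μ / 2 * ‖y - x‖ ^ 2 ≤ f y
  upper : ∀ x y, f y ≤ f x + inner ℝ (G x) (y - x) + L / 2 * ‖y - x‖ ^ 2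
  lipschitz : ∀ x y, ‖G y - G x‖ ≤ L * ‖y - x‖

/-- Two integrations of `m ≤ ψ''`, each replaced by a monotonicity argument. Applied to `f` and to
`-f` along a segment, it yields both quadratic bounds. -/
theorem taylor_lower_bound {ψ ψ' ψ'' : ℝ → ℝ} {m : ℝ} (h₁ : ∀ t, HasDerivAt ψ (ψ' t) t)
    (h₂ : ∀ t, HasDerivAt ψ' (ψ'' t) t) (hm : ∀ t, m ≤ ψ'' t) : ψ 0 + ψ' 0 + m / 2 ≤ ψ 1 := by
  have mono₁ : Monotone fun t => ψ' t - m * t :=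
    monotone_of_hasDerivAt_nonneg (f' := fun t => ψ'' t - m)
      (fun t => ((h₂ t).sub ((hasDerivAt_id t).const_mul m)).congr_deriv (by ring))
      (fun t => sub_nonneg.2 (hm t))
  have hd : ∀ t, HasDerivAt (fun t => ψ t - ψ' 0 * t - m / 2 * t ^ 2) (ψ' t - ψ' 0 - m * t) t := by
    intro t
    exact (((h₁ t).sub ((hasDerivAt_id t).const_mul (ψ' 0))).sub
      ((hasDerivAt_pow 2 t).const_mul (m / 2))).congr_deriv (by norm_num; ring)
  have mono₂ : MonotoneOn (fun t => ψ t - ψ' 0 * t - m / 2 * t ^ 2) (Set.Ici 0) := by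
    refine monotoneOn_of_deriv_nonneg (convex_Ici 0)
      (fun t _ => (hd t).continuousAt.continuousWithinAt)
      (fun t _ => (hd t).differentiableAt.differentiableWithinAt) fun t ht => ?_
    rw [interior_Ici, Set.mem_Ioi] at ht
    have := mono₁ ht.le
    simp only at this
    rw [(hd t).deriv]
    linarith
  have := mono₂ (Set.mem_Ici.2 le_rfl) (Set.mem_Ici.2 zero_le_one) zero_le_one
  simp only at this
  linarith

/-- Cauchy–Schwarz for the semidefinite form `B`, from the discriminant of `t ↦ B (u + t v) (u + t
v)`. It turns the Hessian bound into a Lipschitz bound on the gradient. -/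
theorem norm_le_of_quadratic_form_le {n : ℕ} (B : E n →L[ℝ] E n →L[ℝ] ℝ) {L : ℝ} (hL : 0 ≤ L)
    (hsymm : ∀ u v, B u v = B v u) (hnonneg : ∀ v, 0 ≤ B v v) (hle : ∀ v, B v v ≤ L * ‖v‖ ^ 2) :
    ‖B‖ ≤ L := by
  refine B.opNorm_le_bound₂ hL fun u v => ?_
  have h : discrim (B v v) (2 * B u v) (B u u) ≤ 0 := discrim_le_zero fun t => by
    have h := hnonneg (u + t • v)
    simp only [map_add, map_smul, add_apply, smul_apply,
      smul_eq_mul, hsymm v u] at h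
    linarith
  rw [discrim] at h
  have h2 : B v v * B u u ≤ (L * ‖v‖ ^ 2) * (L * ‖u‖ ^ 2) :=
    mul_le_mul (hle v) (hle u) (hnonneg u) (by positivity)
  rw [Real.norm_eq_abs]
  refine abs_le_of_sq_le_sq ?_ (by positivity)
  nlinarith

theorem Assumptions.exists_quadraticBounds {n : ℕ} {f : E n → ℝ} (hf : Assumptions f) :
    ∃ μ L, QuadraticBounds f (gradient f) μ L := by
  obtain ⟨μ, L, hμ, hμL, hH⟩ := hf.hessian
  have hd : Differentiable ℝ f := hf.contDiff.differentiable (by norm_num)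
  have hd' : Differentiable ℝ (fderiv ℝ f) :=
    (hf.contDiff.fderiv_right (m := 1) (by norm_num)).differentiable (by norm_num)
  have hline : ∀ (x v : E n) (t : ℝ), HasDerivAt (fun t : ℝ => x + t • v) v t := fun x v t => by
    simpa using ((hasDerivAt_id t).smul_const v).const_add x
  have h₁ : ∀ (x v : E n) (t : ℝ),
      HasDerivAt (fun t : ℝ => f (x + t • v)) (fderiv ℝ f (x + t • v) v) t := fun x v t =>
    (hd _).hasFDerivAt.comp_hasDerivAt t (hline x v t)
  have h₂ : ∀ (x v : E n) (t : ℝ), HasDerivAt (fun t : ℝ => fderiv ℝ f (x + t • v) v)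
      (fderiv ℝ (fderiv ℝ f) (x + t • v) v v) t := fun x v t => by
    simpa using ((hd' _).hasFDerivAt.comp_hasDerivAt t (hline x v t)).clm_apply
      (hasDerivAt_const t v)
  refine ⟨μ, L, hμ, hμL, hd.continuous, fun x y => ?_, fun x y => ?_, fun x y => ?_⟩
  · have := taylor_lower_bound (h₁ x (y - x)) (h₂ x (y - x)) fun t => (hH _ _).1
    simp only [zero_smul, add_zero, one_smul, add_sub_cancel] at this
    rw [inner_gradient_left]
    linarith
  · have := taylor_lower_bound (fun t => (h₁ x (y - x) t).neg) (fun t => (h₂ x (y - x) t).neg)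
      fun t => neg_le_neg (hH _ _).2
    simp only [Pi.neg_apply, zero_smul, add_zero, one_smul, add_sub_cancel] at this
    rw [inner_gradient_left]
    linarith
  · have hnorm : ∀ z, ‖fderiv ℝ (fderiv ℝ f) z‖ ≤ L := fun z =>
      norm_le_of_quadratic_form_le _ (hμ.le.trans hμL)
        (fun u v => hf.contDiff.contDiffAt.isSymmSndFDerivAt (by simp) u v)
        (fun v => le_trans (by positivity) (hH z v).1) (fun v => (hH z v).2)
    have := convex_univ.norm_image_sub_le_of_norm_fderiv_le (fun z _ => hd' z)
      (fun z _ => hnorm z) (Set.mem_univ x) (Set.mem_univ y)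
    rwa [gradient, gradient, ← map_sub, LinearIsometryEquiv.norm_map]

namespace QuadraticBounds

variable {n : ℕ} {f : E n → ℝ} {G : E n → E n} {μ L : ℝ}

theorem strongly_monotone (h : QuadraticBounds f G μ L) (x y : E n) :
    μ * ‖y - x‖ ^ 2 ≤ inner ℝ (y - x) (G y - G x) := by
  have h₁ := h.lower x y
  have h₂ := h.lower y x
  rw [← neg_sub y x, inner_neg_right, norm_neg] at h₂
  rw [real_inner_comm, inner_sub_left]
  linarith

theorem exists_isMinOn (h : QuadraticBounds f G μ L) {C : Set (E n)} (hC : IsClosed C) {x₀ : E n}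
    (hx₀ : x₀ ∈ C) : ∃ xs ∈ C, IsMinOn f C xs := by
  refine h.cont.continuousOn.exists_isMinOn' hC hx₀ ?_
  refine Filter.Eventually.filter_mono inf_le_left ?_
  have hμ := h.pos
  -- At distance `r` from `x₀` the lower bound gives `f y - f x₀ ≥ r (μ r / 2 - ‖G x₀‖)`,
  -- nonnegative beyond this radius.
  refine Filter.mem_of_superset
    (isCompact_closedBall x₀ (2 * ‖G x₀‖ / μ)).compl_mem_cocompact fun y hy => ?_
  rw [Set.mem_compl_iff, Metric.mem_closedBall, not_le, dist_eq_norm, div_lt_iff₀ hμ] at hy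
  have h₁ := h.lower x₀ y
  have h₂ := (abs_le.1 (abs_real_inner_le_norm (G x₀) (y - x₀))).1
  have h₃ : 0 ≤ ‖y - x₀‖ := norm_nonneg _
  show f x₀ ≤ f y
  nlinarith

theorem le_of_isMinOn (h : QuadraticBounds f G μ L) {C : Set (E n)} (hC : Convex ℝ C) {xs x : E n}
    (hxs : xs ∈ C) (hmin : IsMinOn f C xs) (hx : x ∈ C) :
    f xs + μ / 2 * ‖x - xs‖ ^ 2 ≤ f x := by
  have hinner : 0 ≤ inner ℝ (G xs) (x - xs) := by
    by_contra! hneg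
    set p := inner ℝ (G xs) (x - xs)
    set q := ‖x - xs‖ ^ 2
    have hq : 0 ≤ q := by positivity
    have hL : 0 < L := h.pos.trans_le h.le
    -- A step short enough that the linear term `p < 0` beats `L/2 * t * q`; the `+ 1` keeps the
    -- denominator positive without treating `q = 0` apart.
    set t := min 1 (-p / (L * q + 1)) with ht
    have ht0 : 0 < t := lt_min one_pos (div_pos (by linarith) (by positivity))
    have ht1 : t ≤ 1 := min_le_left _ _
    have htp : t * (L * q + 1) ≤ -p :=
      (le_div_iff₀ (by positivity)).1 (min_le_right _ _)
    have hmem : xs + t • (x - xs) ∈ C := hC.add_smul_sub_mem hxs hx ⟨ht0.le, ht1⟩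
    have h₁ : f xs ≤ f (xs + t • (x - xs)) := hmin hmem
    have h₂ := h.upper xs (xs + t • (x - xs))
    rw [add_sub_cancel_left, inner_smul_right, norm_smul, mul_pow, Real.norm_eq_abs, sq_abs] at h₂
    change f (xs + t • (x - xs)) ≤ f xs + t * p + L / 2 * (t ^ 2 * q) at h₂
    have h₃ : 0 ≤ t * (p + L / 2 * t * q) := by nlinarith
    have h₄ : 0 ≤ p + L / 2 * t * q := nonneg_of_mul_nonneg_right h₃ ht0
    have h₅ : 0 ≤ L * q * t := by positivity
    nlinarith
  have := h.lower xs x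
  linarith

/-- A point whose gradient is, on `C`, bounded below by the linear functional `p` has function
value at most `‖p‖² / (2 μ)` above every value on `C`. -/
theorem sub_le_of_inner_le (h : QuadraticBounds f G μ L) {x y p : E n}
    (hp : inner ℝ p (y - x) ≤ inner ℝ (G x) (y - x)) : f x - f y ≤ ‖p‖ ^ 2 / (2 * μ) := by
  have hμ := h.pos
  have h₁ := h.lower x y
  have h₂ := (abs_le.1 (abs_real_inner_le_norm p (y - x))).1
  rw [le_div_iff₀ (by positivity)]
  nlinarith [sq_nonneg (‖p‖ - μ * ‖y - x‖)]

end QuadraticBounds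

/-! ### Bounds on the L-BFGS matrices -/

theorem dotProduct_self_nonneg {k : ℕ} (u : Fin k → ℝ) : 0 ≤ u ⬝ᵥ u :=
  Finset.sum_nonneg fun _ _ => mul_self_nonneg _

theorem dotProduct_sq_le {k : ℕ} (u v : Fin k → ℝ) : (u ⬝ᵥ v) ^ 2 ≤ (u ⬝ᵥ u) * (v ⬝ᵥ v) := by
  have := Finset.sum_mul_sq_le_sq_mul_sq Finset.univ u v
  simpa only [dotProduct, ← sq] using this

theorem dotProduct_add_smul_self_le {k : ℕ} (u v : Fin k → ℝ) (c : ℝ) :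
    (u + c • v) ⬝ᵥ (u + c • v) ≤ 2 * (u ⬝ᵥ u) + 2 * (c ^ 2 * (v ⬝ᵥ v)) := by
  have h : 0 ≤ (u - c • v) ⬝ᵥ (u - c • v) := dotProduct_self_nonneg _
  simp only [sub_dotProduct, dotProduct_sub, add_dotProduct, dotProduct_add, smul_dotProduct,
    dotProduct_smul, smul_eq_mul] at h ⊢
  linarith

/-- `a ‖v‖² ≤ vᵀ H v` and `‖H v‖² ≤ b ‖v‖²` for all `v`. -/
def MatrixBounds {k : ℕ} (a b : ℝ) (H : Matrix (Fin k) (Fin k) ℝ) : Prop :=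
  ∀ v, a * (v ⬝ᵥ v) ≤ v ⬝ᵥ H.mulVec v ∧ H.mulVec v ⬝ᵥ H.mulVec v ≤ b * (v ⬝ᵥ v)

theorem MatrixBounds.mono {k : ℕ} {a b a' b' : ℝ} {H : Matrix (Fin k) (Fin k) ℝ}
    (h : MatrixBounds a b H) (ha : a' ≤ a) (hb : b ≤ b') : MatrixBounds a' b' H := fun v =>
  have hv : 0 ≤ v ⬝ᵥ v := dotProduct_self_nonneg v
  ⟨(mul_le_mul_of_nonneg_right ha hv).trans (h v).1,
    (h v).2.trans (mul_le_mul_of_nonneg_right hb hv)⟩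

/-- With `w = V v` and `z = H w`, the updated matrix sends `v` to `z` plus a multiple of `s`; only
these vectors need estimates. -/
theorem bfgsUpdate_mulVec {k : ℕ} (H : Matrix (Fin k) (Fin k) ℝ) (s y v : Fin k → ℝ) :
    (bfgsUpdate H s y).mulVec v =
      H.mulVec (v + (-((y ⬝ᵥ s)⁻¹ * (s ⬝ᵥ v))) • y) +
        ((y ⬝ᵥ s)⁻¹ * (s ⬝ᵥ v) -
          (y ⬝ᵥ s)⁻¹ * (y ⬝ᵥ H.mulVec (v + (-((y ⬝ᵥ s)⁻¹ * (s ⬝ᵥ v))) • y))) • s := by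
  have hV : (1 - (y ⬝ᵥ s)⁻¹ • Matrix.vecMulVec y s).mulVec v =
      v + (-((y ⬝ᵥ s)⁻¹ * (s ⬝ᵥ v))) • y := by
    rw [Matrix.sub_mulVec, Matrix.one_mulVec, Matrix.smul_mulVec, Matrix.vecMulVec_mulVec]
    ext i
    simp
    ring
  simp only [bfgsUpdate]
  rw [Matrix.add_mulVec, ← Matrix.mulVec_mulVec, ← Matrix.mulVec_mulVec, hV]
  generalize H.mulVec (v + (-((y ⬝ᵥ s)⁻¹ * (s ⬝ᵥ v))) • y) = z
  rw [Matrix.transpose_sub, Matrix.transpose_one, Matrix.transpose_smul,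
    Matrix.transpose_vecMulVec, Matrix.sub_mulVec, Matrix.one_mulVec, Matrix.smul_mulVec,
    Matrix.smul_mulVec, Matrix.vecMulVec_mulVec, Matrix.vecMulVec_mulVec]
  ext i
  simp
  ring

/-- The updated form at `v` is `w ⬝ z + ρ (s ⬝ v)²`. Since `v = w + ρ (s ⬝ v) y`, its two terms
control `‖v‖²`, by `a` and `B` respectively. The upper bound follows from Cauchy–Schwarz on each
piece of `z + c s`. -/
theorem MatrixBounds.bfgsUpdate {k : ℕ} {a b A B : ℝ} {H : Matrix (Fin k) (Fin k) ℝ}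
    (h : MatrixBounds a b H) (ha : 0 < a) (hb : 0 ≤ b) (hA : 0 ≤ A) (hB : 0 ≤ B)
    {s y : Fin k → ℝ} (hρ : 0 ≤ (y ⬝ᵥ s)⁻¹) (hs : (y ⬝ᵥ s)⁻¹ * (s ⬝ᵥ s) ≤ A)
    (hy : (y ⬝ᵥ s)⁻¹ * (y ⬝ᵥ y) ≤ B) :
    MatrixBounds (2 / a + 2 * B)⁻¹ ((2 + 4 * (A * B)) * (b * (2 + 2 * (A * B))) + 4 * A ^ 2)
      (bfgsUpdate H s y) := by
  intro v
  rw [bfgsUpdate_mulVec]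
  set ρ := (y ⬝ᵥ s)⁻¹
  set w := v + (-(ρ * (s ⬝ᵥ v))) • y with hw
  set z := H.mulVec w with hz
  obtain ⟨h₁, h₂⟩ := h w
  rw [← hz] at h₁ h₂
  have hvv : 0 ≤ v ⬝ᵥ v := dotProduct_self_nonneg v
  have hss : 0 ≤ s ⬝ᵥ s := dotProduct_self_nonneg s
  have hyy : 0 ≤ y ⬝ᵥ y := dotProduct_self_nonneg y
  have hzz : 0 ≤ z ⬝ᵥ z := dotProduct_self_nonneg z
  have hsv : ρ * (s ⬝ᵥ v) ^ 2 ≤ A * (v ⬝ᵥ v) := calc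
    ρ * (s ⬝ᵥ v) ^ 2 ≤ ρ * ((s ⬝ᵥ s) * (v ⬝ᵥ v)) :=
      mul_le_mul_of_nonneg_left (dotProduct_sq_le s v) hρ
    _ = ρ * (s ⬝ᵥ s) * (v ⬝ᵥ v) := by ring
    _ ≤ _ := mul_le_mul_of_nonneg_right hs hvv
  have hyz : ρ * (y ⬝ᵥ z) ^ 2 ≤ B * (z ⬝ᵥ z) := calc
    ρ * (y ⬝ᵥ z) ^ 2 ≤ ρ * ((y ⬝ᵥ y) * (z ⬝ᵥ z)) :=
      mul_le_mul_of_nonneg_left (dotProduct_sq_le y z) hρ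
    _ = ρ * (y ⬝ᵥ y) * (z ⬝ᵥ z) := by ring
    _ ≤ _ := mul_le_mul_of_nonneg_right hy hzz
  have hsv0 : 0 ≤ ρ * (s ⬝ᵥ v) ^ 2 := by positivity
  have hyz0 : 0 ≤ ρ * (y ⬝ᵥ z) ^ 2 := by positivity
  have hsvy : (ρ * (s ⬝ᵥ v)) ^ 2 * (y ⬝ᵥ y) ≤ B * (ρ * (s ⬝ᵥ v) ^ 2) := calc
    (ρ * (s ⬝ᵥ v)) ^ 2 * (y ⬝ᵥ y) = ρ * (y ⬝ᵥ y) * (ρ * (s ⬝ᵥ v) ^ 2) := by ring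
    _ ≤ _ := mul_le_mul_of_nonneg_right hy hsv0
  constructor
  · have hv : v = w + (ρ * (s ⬝ᵥ v)) • y := by
      rw [hw, neg_smul, neg_add_cancel_right]
    have h₃ : v ⬝ᵥ v ≤ 2 * (w ⬝ᵥ w) + 2 * ((ρ * (s ⬝ᵥ v)) ^ 2 * (y ⬝ᵥ y)) := by
      conv_lhs => rw [hv]
      exact dotProduct_add_smul_self_le _ _ _
    have h₄ : v ⬝ᵥ (z + (ρ * (s ⬝ᵥ v) - ρ * (y ⬝ᵥ z)) • s) = w ⬝ᵥ z + ρ * (s ⬝ᵥ v) ^ 2 := by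
      rw [hw]
      simp only [dotProduct_add, add_dotProduct, dotProduct_smul, smul_dotProduct, smul_eq_mul,
        dotProduct_comm v s]
      ring
    have h₅ : w ⬝ᵥ w ≤ (w ⬝ᵥ z) / a := by rwa [le_div_iff₀ ha, mul_comm]
    have h₆ : 0 ≤ w ⬝ᵥ z := le_trans (mul_nonneg ha.le (dotProduct_self_nonneg w)) h₁
    have h₇ : 0 ≤ B * (w ⬝ᵥ z) := mul_nonneg hB h₆
    have h₈ : 0 ≤ 2 / a * (ρ * (s ⬝ᵥ v) ^ 2) := by positivity
    rw [h₄, inv_mul_le_iff₀ (by positivity)]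
    calc v ⬝ᵥ v ≤ 2 * ((w ⬝ᵥ z) / a) + 2 * (B * (ρ * (s ⬝ᵥ v) ^ 2)) := by linarith
      _ ≤ 2 * ((w ⬝ᵥ z) / a) + 2 * (B * (ρ * (s ⬝ᵥ v) ^ 2)) + 2 * (B * (w ⬝ᵥ z)) +
          2 / a * (ρ * (s ⬝ᵥ v) ^ 2) := by linarith
      _ = _ := by ring
  · have hww : w ⬝ᵥ w ≤ (2 + 2 * (A * B)) * (v ⬝ᵥ v) := by
      have h₃ := dotProduct_add_smul_self_le v y (-(ρ * (s ⬝ᵥ v)))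
      rw [← hw, neg_sq] at h₃
      have h₄ := mul_le_mul_of_nonneg_left hsv hB
      linarith
    have hzz' : z ⬝ᵥ z ≤ b * (2 + 2 * (A * B)) * (v ⬝ᵥ v) := by
      have := mul_le_mul_of_nonneg_left hww hb
      linarith
    set c := ρ * (s ⬝ᵥ v) - ρ * (y ⬝ᵥ z) with hc
    have hcs : c ^ 2 * (s ⬝ᵥ s) ≤ 2 * (A * (A * (v ⬝ᵥ v))) + 2 * (A * (B * (z ⬝ᵥ z))) := by
      have h₃ : c ^ 2 ≤ 2 * ρ * (ρ * (s ⬝ᵥ v) ^ 2) + 2 * ρ * (ρ * (y ⬝ᵥ z) ^ 2) := by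
        rw [hc]
        linarith [sq_nonneg (ρ * (s ⬝ᵥ v) + ρ * (y ⬝ᵥ z))]
      have h₄ := mul_le_mul_of_nonneg_right h₃ hss
      have h₅ := mul_le_mul hs hsv hsv0 hA
      have h₆ := mul_le_mul hs hyz hyz0 hA
      linarith
    have h₃ := dotProduct_add_smul_self_le z s c
    have h₄ := mul_le_mul_of_nonneg_left hzz' (show 0 ≤ 2 + 4 * (A * B) by positivity)
    linarith

/-- A pair `(s, y)` with `μ ‖s‖² ≤ sᵀ y` and `‖y‖² ≤ L² ‖s‖²`. -/
def IsCurvaturePair {k : ℕ} (μ L : ℝ) (p : (Fin k → ℝ) × (Fin k → ℝ)) : Prop :=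
  μ * (p.1 ⬝ᵥ p.1) ≤ p.1 ⬝ᵥ p.2 ∧ p.2 ⬝ᵥ p.2 ≤ L ^ 2 * (p.1 ⬝ᵥ p.1)

theorem IsCurvaturePair.bounds {k : ℕ} {μ L : ℝ} (hμ : 0 < μ) {p : (Fin k → ℝ) × (Fin k → ℝ)}
    (h : IsCurvaturePair μ L p) : 0 ≤ (p.2 ⬝ᵥ p.1)⁻¹ ∧
      (p.2 ⬝ᵥ p.1)⁻¹ * (p.1 ⬝ᵥ p.1) ≤ 1 / μ ∧ (p.2 ⬝ᵥ p.1)⁻¹ * (p.2 ⬝ᵥ p.2) ≤ L ^ 2 / μ := by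
  obtain ⟨h₁, h₂⟩ := h
  have hss : 0 ≤ p.1 ⬝ᵥ p.1 := dotProduct_self_nonneg _
  rw [dotProduct_comm p.2 p.1]
  have hsy : 0 ≤ p.1 ⬝ᵥ p.2 := le_trans (by positivity) h₁
  have hs : (p.1 ⬝ᵥ p.2)⁻¹ * (p.1 ⬝ᵥ p.1) ≤ 1 / μ := by
    -- For a zero pair the convention `0⁻¹ = 0` makes `ρ = 0`, so the bound is trivial.
    rcases hsy.eq_or_lt with h0 | h0
    · rw [← h0, inv_zero, zero_mul]
      positivity
    · rw [inv_mul_le_iff₀ h0, mul_one_div, le_div_iff₀ hμ]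
      linarith
  refine ⟨inv_nonneg.2 hsy, hs, ?_⟩
  calc (p.1 ⬝ᵥ p.2)⁻¹ * (p.2 ⬝ᵥ p.2) ≤ (p.1 ⬝ᵥ p.2)⁻¹ * (L ^ 2 * (p.1 ⬝ᵥ p.1)) :=
        mul_le_mul_of_nonneg_left h₂ (inv_nonneg.2 hsy)
    _ = L ^ 2 * ((p.1 ⬝ᵥ p.2)⁻¹ * (p.1 ⬝ᵥ p.1)) := by ring
    _ ≤ L ^ 2 * (1 / μ) := mul_le_mul_of_nonneg_left hs (by positivity)
    _ = _ := by ring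

/-- At most `N` updates start from `h₀ I`, so the one-update bound is iterated boundedly often. The
constants do not depend on `k`, hence serve all faces at once; `min` and `max` keep them valid for
shorter lists. -/
theorem exists_matrixBounds_lbfgsMatrix {h₀ μ L : ℝ} (hh₀ : 0 < h₀) (hμ : 0 < μ) (N : ℕ) :
    ∃ a b : ℝ, 0 < a ∧ 0 < b ∧ ∀ (k : ℕ) (ps : List ((Fin k → ℝ) × (Fin k → ℝ))),
      ps.length ≤ N → (∀ p ∈ ps, IsCurvaturePair μ L p) → MatrixBounds a b (lbfgsMatrix h₀ ps) := by
  induction N with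
  | zero =>
    refine ⟨h₀, h₀ ^ 2, hh₀, by positivity, fun k ps hps _ v => ?_⟩
    rw [List.length_eq_zero_iff.1 (Nat.le_zero.1 hps)]
    simp only [lbfgsMatrix, Matrix.smul_mulVec, Matrix.one_mulVec, dotProduct_smul,
      smul_dotProduct, smul_eq_mul]
    exact ⟨le_rfl, by linarith⟩
  | succ N ih =>
    obtain ⟨a, b, ha, hb, h⟩ := ih
    have hA : 0 ≤ 1 / μ := by positivity
    have hB : 0 ≤ L ^ 2 / μ := by positivity
    refine ⟨min a (2 / a + 2 * (L ^ 2 / μ))⁻¹,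
      max b ((2 + 4 * (1 / μ * (L ^ 2 / μ))) * (b * (2 + 2 * (1 / μ * (L ^ 2 / μ)))) +
        4 * (1 / μ) ^ 2), lt_min ha (by positivity),
      lt_max_of_lt_left hb, fun k ps hps hp => ?_⟩
    cases ps with
    | nil => exact (h k [] (Nat.zero_le _) (by simp)).mono (min_le_left _ _) (le_max_left _ _)
    | cons p ps =>
      obtain ⟨h₁, h₂, h₃⟩ := (hp p List.mem_cons_self).bounds hμ
      exact ((h k ps (by simpa using hps) fun q hq => hp q (List.mem_cons_of_mem p hq)).bfgsUpdate
        ha hb.le hA hB h₁ h₂ h₃).mono (min_le_right _ _) (le_max_right _ _)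

/-! ### Face coordinates -/

/-- The coordinates `Φ(F)ᵀ v`. -/
noncomputable def faceCoord {n : ℕ} (Φ : FaceBasis n) (F : Set (E n)) (v : E n) :
    Fin (Module.finrank ℝ (vectorSpan ℝ F)) → ℝ :=
  (basisMatrix Φ F).transpose.mulVec (WithLp.ofLp v)

/-- The vector `Φ(F) u` with coordinates `u`. -/
noncomputable def faceVec {n : ℕ} (Φ : FaceBasis n) (F : Set (E n))
    (u : Fin (Module.finrank ℝ (vectorSpan ℝ F)) → ℝ) : E n :=
  WithLp.toLp 2 ((basisMatrix Φ F).mulVec u)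

section FaceCoord

variable {n : ℕ} (Φ : FaceBasis n) (F : Set (E n))

theorem faceCoord_apply (v : E n) (j) : faceCoord Φ F v j = inner ℝ (Φ F j : E n) v := by
  simp [faceCoord, basisMatrix, Matrix.mulVec, dotProduct, PiLp.inner_apply, mul_comm]

theorem faceVec_eq_sum (u : Fin (Module.finrank ℝ (vectorSpan ℝ F)) → ℝ) :
    faceVec Φ F u = ∑ j, u j • (Φ F j : E n) := by
  ext i
  simp [faceVec, basisMatrix, Matrix.mulVec, dotProduct, mul_comm]

theorem inner_faceVec (v : E n) (u : Fin (Module.finrank ℝ (vectorSpan ℝ F)) → ℝ) :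
    inner ℝ v (faceVec Φ F u) = faceCoord Φ F v ⬝ᵥ u := by
  simp only [faceVec_eq_sum, inner_sum, inner_smul_right, dotProduct, faceCoord_apply]
  exact Finset.sum_congr rfl fun j _ => by rw [real_inner_comm, mul_comm]

theorem faceVec_faceCoord {v : E n} (hv : v ∈ vectorSpan ℝ F) :
    faceVec Φ F (faceCoord Φ F v) = v := by
  have := congrArg (Subtype.val) ((Φ F).sum_repr' ⟨v, hv⟩)
  simpa [faceVec_eq_sum, faceCoord_apply] using this

theorem faceCoord_faceVec (u : Fin (Module.finrank ℝ (vectorSpan ℝ F)) → ℝ) :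
    faceCoord Φ F (faceVec Φ F u) = u := by
  have horth : ∀ i j, inner ℝ (Φ F i : E n) (Φ F j : E n) = if i = j then (1 : ℝ) else 0 :=
    fun i j => (orthonormal_iff_ite.1 (Φ F).orthonormal) i j
  ext j
  simp [faceVec_eq_sum, faceCoord_apply, inner_sum, inner_smul_right, horth]

theorem norm_faceVec_sq (u : Fin (Module.finrank ℝ (vectorSpan ℝ F)) → ℝ) :
    ‖faceVec Φ F u‖ ^ 2 = u ⬝ᵥ u := by
  rw [← real_inner_self_eq_norm_sq, inner_faceVec, faceCoord_faceVec]

/-- Bessel's inequality for the orthonormal columns of `Φ`. -/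
theorem faceCoord_dotProduct_self_le (v : E n) :
    faceCoord Φ F v ⬝ᵥ faceCoord Φ F v ≤ ‖v‖ ^ 2 := by
  have h₁ := inner_faceVec Φ F v (faceCoord Φ F v)
  have h₂ := norm_faceVec_sq Φ F (faceCoord Φ F v)
  have h₃ := real_inner_le_norm v (faceVec Φ F (faceCoord Φ F v))
  nlinarith [norm_nonneg v, norm_nonneg (faceVec Φ F (faceCoord Φ F v)),
    sq_nonneg (‖v‖ - ‖faceVec Φ F (faceCoord Φ F v)‖)]

theorem qnDirection_eq (h₀ : ℝ) (pairs : List (E n × E n)) (g : E n) :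
    qnDirection Φ h₀ F pairs g =
      -faceVec Φ F ((faceMatrix Φ h₀ F pairs).mulVec (faceCoord Φ F g)) := by
  simp only [qnDirection, faceVec, faceCoord, Matrix.mulVec_mulVec, Matrix.mul_assoc]

end FaceCoord

/-! ### Projections and self-projection cones -/

theorem IsProjection.inner_le_zero {n : ℕ} {C : Set (E n)} (hC : Convex ℝ C) {v z : E n}
    (h : IsProjection C v z) {y : E n} (hy : y ∈ C) : inner ℝ (v - z) (y - z) ≤ 0 := by
  refine (norm_eq_iInf_iff_real_inner_le_zero hC h.1).1 ?_ y hy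
  have : Nonempty C := ⟨⟨z, h.1⟩⟩
  refine le_antisymm (le_ciInf fun w => ?_)
    (ciInf_le (f := fun w : C => ‖v - w‖) ⟨0, by rintro _ ⟨w, rfl⟩; exact norm_nonneg _⟩ ⟨z, h.1⟩)
  rw [norm_sub_rev v z, norm_sub_rev v w]
  exact h.2 w.2

/-- The residual `w` of projecting `x - ε g` to `z` is normal to `C` at `z`. As `z` is relatively
interior to `F`, `w` is orthogonal to `F`, so `z - x = -ε p` with `p = Φ Φᵀ g`, and `w = ε (p - g)`.
Normality of `w` then gives the inequality. -/
theorem inner_faceVec_le_of_neg_mem_selfProjCone {n : ℕ} {C : Set (E n)} (hC : IsPolyhedral C)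
    (Φ : FaceBasis n) {x g y : E n} (hx : x ∈ C) (hg : -g ∈ selfProjCone C x) (hy : y ∈ C) :
    inner ℝ (faceVec Φ (faceAt C x) (faceCoord Φ (faceAt C x) g)) (y - x) ≤ inner ℝ g (y - x) := by
  obtain ⟨ε, hε, hface⟩ := hg
  set z := proj C (x + ε • -g) with hz
  have hproj : IsProjection C (x + ε • -g) z := proj_spec hC ⟨x, hx⟩ _
  set F := faceAt C x
  set w := x + ε • -g - z with hw
  have hwz : ∀ y ∈ C, inner ℝ w (y - z) ≤ 0 := fun y hy => hproj.inner_le_zero hC.convex hy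
  obtain ⟨hF, hxF⟩ := faceAt_spec hC hx
  have hzF : z ∈ intrinsicInterior ℝ F := by
    rw [← hface]
    exact (faceAt_spec hC hproj.1).2
  -- `D` is the face exposed by `w`. It contains `z`, a relative interior point of `F`, hence all of
  -- `F`; so `w` is constant on `F`.
  let D : Set (E n) := {y | y ∈ C ∧ ∀ u ∈ C, innerSL ℝ w u ≤ innerSL ℝ w y}
  have hzD : z ∈ D := ⟨hproj.1, fun u hu => by
    have := hwz u hu
    rw [inner_sub_right] at this
    simpa using this⟩
  have hFD : F ⊆ D := face_subset_of_mem hF ⟨⟨z, hzD⟩, fun _ => ⟨innerSL ℝ w, rfl⟩⟩ hzF hzD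
  have horth : ∀ v ∈ vectorSpan ℝ F, inner ℝ v w = 0 := by
    intro v hv
    refine Submodule.span_induction (p := fun v _ => inner ℝ v w = 0) ?_ (inner_zero_left _)
      (fun u v _ _ hu hv => by rw [inner_add_left, hu, hv, add_zero])
      (fun c u _ hu => by rw [inner_smul_left, hu, mul_zero]) hv
    rintro _ ⟨u, hu, u', hu', rfl⟩
    have h₁ := (hFD hu).2 u' (hFD hu').1
    have h₂ := (hFD hu').2 u (hFD hu).1
    simp only [innerSL_apply_apply] at h₁ h₂
    show inner ℝ (u - u') w = 0
    rw [real_inner_comm, inner_sub_right]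
    linarith
  set p := faceVec Φ F (faceCoord Φ F g) with hp
  have hzx : z - x ∈ vectorSpan ℝ F :=
    vsub_mem_vectorSpan ℝ (intrinsicInterior_subset hzF) (intrinsicInterior_subset hxF)
  have hcoord : faceCoord Φ F (z - x) = (-ε) • faceCoord Φ F g := by
    ext j
    have h₁ := horth _ (Φ F j).2
    have h₂ : z - x = (-ε) • g - w := by
      rw [hw, smul_neg, neg_smul]
      abel
    rw [Pi.smul_apply, faceCoord_apply, faceCoord_apply, h₂, inner_sub_right, h₁, inner_smul_right]
    simp
  have hpz : z - x = (-ε) • p := by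
    rw [← faceVec_faceCoord Φ F hzx, hcoord, hp, faceVec_eq_sum, faceVec_eq_sum, Finset.smul_sum]
    exact Finset.sum_congr rfl fun j _ => by rw [Pi.smul_apply, smul_smul, smul_eq_mul]
  have hwp : w = ε • (p - g) := by
    have : w = -(z - x) - ε • g := by
      rw [hw, smul_neg]
      abel
    rw [this, hpz, neg_smul, neg_neg, smul_sub]
  have h₁ : inner ℝ w (y - x) ≤ 0 := by
    have h₂ := hwz y hy
    have h₃ := horth _ hzx
    rw [real_inner_comm] at h₃
    rw [← sub_add_sub_cancel y z x, inner_add_right, h₃, add_zero]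
    exact h₂
  rw [hwp, inner_smul_left, inner_sub_left] at h₁
  have h₂ := nonpos_of_mul_nonpos_right h₁ (by simpa using hε)
  linarith

/-! ### The quadratic model -/

/-- A model survives only while the face is unchanged, so every stored displacement is parallel to
the current face. -/
theorem model_eq_some {n : ℕ} {P : Params} {f : E n → ℝ} {C : Set (E n)} (hC : IsPolyhedral C)
    {x : ℕ → E n} (hx : ∀ t, x t ∈ C) {t : ℕ} {pairs : List (E n × E n)}
    (h : model P f C x t = some pairs) :
    pairs.length ≤ P.N ∧ -gradient f (x t) ∈ selfProjCone C (x t) ∧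
      ∀ p ∈ pairs, p.1 ∈ vectorSpan ℝ (faceAt C (x t)) ∧
        ∃ u v, p.1 = u - v ∧ p.2 = gradient f u - gradient f v := by
  induction t generalizing pairs with
  | zero => simp [model] at h
  | succ t ih =>
    rw [model] at h
    split_ifs at h with hcond
    obtain ⟨hface, hcone⟩ := hcond
    obtain rfl := Option.some.inj h
    refine ⟨List.length_take_le _ _, hcone, fun p hp => ?_⟩
    rcases List.mem_cons.1 (List.mem_of_mem_take hp) with rfl | hp
    · refine ⟨vsub_mem_vectorSpan ℝ (intrinsicInterior_subset (faceAt_spec hC (hx _)).2) ?_,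
        _, _, rfl, rfl⟩
      rw [hface]
      exact intrinsicInterior_subset (faceAt_spec hC (hx _)).2
    · rw [hface]
      cases hm : model P f C x t with
      | none => simp [hm] at hp
      | some l =>
        rw [hm, Option.getD_some] at hp
        exact (ih hm).2.2 p hp

namespace QuadraticBounds

variable {n : ℕ} {f : E n → ℝ} {G : E n → E n} {μ L : ℝ}

/-- `Φᵀ` preserves the norm of `u - v` and its inner product with the gradient difference because `u
- v` is parallel to `F`; the gradient difference itself can only shrink. -/
theorem isCurvaturePair (h : QuadraticBounds f G μ L) (Φ : FaceBasis n) (F : Set (E n))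
    {u v : E n} (huv : u - v ∈ vectorSpan ℝ F) :
    IsCurvaturePair μ L (faceCoord Φ F (u - v), faceCoord Φ F (G u - G v)) := by
  have h₁ : faceCoord Φ F (u - v) ⬝ᵥ faceCoord Φ F (u - v) = ‖u - v‖ ^ 2 := by
    rw [← inner_faceVec, faceVec_faceCoord Φ F huv, real_inner_self_eq_norm_sq]
  have h₂ : faceCoord Φ F (u - v) ⬝ᵥ faceCoord Φ F (G u - G v) = inner ℝ (u - v) (G u - G v) := by
    rw [dotProduct_comm, ← inner_faceVec, faceVec_faceCoord Φ F huv, real_inner_comm]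
  refine ⟨?_, ?_⟩
  · simp only [h₁, h₂]
    exact h.strongly_monotone v u
  · simp only [h₁]
    calc _ ≤ ‖G u - G v‖ ^ 2 := faceCoord_dotProduct_self_le Φ F _
      _ ≤ (L * ‖u - v‖) ^ 2 := pow_le_pow_left₀ (norm_nonneg _) (h.lipschitz v u) 2
      _ = _ := by ring

/-- Sufficient decrease of a quasi-Newton step that satisfies the Wolfe conditions. -/
theorem wolfe_decrease (h : QuadraticBounds f G μ L) (Φ : FaceBasis n) (F : Set (E n))
    {a b γ₁ γ₂ η : ℝ} (ha : 0 < a) (hb : 0 < b) (hγ₁ : 0 < γ₁) (hγ₂ : γ₂ < 1) (hη : 0 ≤ η)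
    {H : Matrix (Fin (Module.finrank ℝ (vectorSpan ℝ F)))
      (Fin (Module.finrank ℝ (vectorSpan ℝ F))) ℝ} (hH : MatrixBounds a b H) {x d : E n}
    (hd : d = -faceVec Φ F (H.mulVec (faceCoord Φ F (G x))))
    (h₁ : f (x + η • d) ≤ f x + γ₁ * η * inner ℝ (G x) d)
    (h₂ : γ₂ * inner ℝ (G x) d ≤ inner ℝ (G (x + η • d)) d) :
    f (x + η • d) ≤ f x - γ₁ * (1 - γ₂) * a ^ 2 / (L * b) *
      (faceCoord Φ F (G x) ⬝ᵥ faceCoord Φ F (G x)) := by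
  have hL : 0 < L := h.pos.trans_le h.le
  obtain ⟨hl, hu⟩ := hH (faceCoord Φ F (G x))
  have hdd : ‖d‖ ^ 2 = H.mulVec (faceCoord Φ F (G x)) ⬝ᵥ H.mulVec (faceCoord Φ F (G x)) := by
    rw [hd, norm_neg, norm_faceVec_sq]
  have hgd : inner ℝ (G x) d = -(faceCoord Φ F (G x) ⬝ᵥ H.mulVec (faceCoord Φ F (G x))) := by
    rw [hd, inner_neg_right, inner_faceVec]
  rw [hgd] at h₁ h₂
  rw [← hdd] at hu
  set U := faceCoord Φ F (G x) ⬝ᵥ faceCoord Φ F (G x)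
  set D := faceCoord Φ F (G x) ⬝ᵥ H.mulVec (faceCoord Φ F (G x))
  -- The curvature condition against the Lipschitz bound forces `η` not to be too small.
  have hcurv : (1 - γ₂) * D ≤ L * η * (b * U) := by
    have h₃ : inner ℝ (G (x + η • d) - G x) d ≤ L * η * ‖d‖ ^ 2 := by
      have h₄ := h.lipschitz x (x + η • d)
      rw [add_sub_cancel_left, norm_smul, Real.norm_of_nonneg hη] at h₄
      calc _ ≤ ‖G (x + η • d) - G x‖ * ‖d‖ := real_inner_le_norm _ _
        _ ≤ L * (η * ‖d‖) * ‖d‖ := mul_le_mul_of_nonneg_right h₄ (norm_nonneg _)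
        _ = _ := by ring
    rw [inner_sub_left, hgd] at h₃
    have h₄ := mul_le_mul_of_nonneg_left hu (mul_nonneg hL.le hη)
    linarith
  have hγ : 0 < 1 - γ₂ := by linarith
  -- `a * U ≤ D` is used twice, which avoids dividing by `U` or `D`.
  have h₃ : (1 - γ₂) * a ^ 2 * U ≤ L * b * (η * D) := calc
    (1 - γ₂) * a ^ 2 * U = (1 - γ₂) * a * (a * U) := by ring
    _ ≤ (1 - γ₂) * a * D := mul_le_mul_of_nonneg_left hl (by positivity)
    _ = a * ((1 - γ₂) * D) := by ring
    _ ≤ a * (L * η * (b * U)) := mul_le_mul_of_nonneg_left hcurv ha.le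
    _ = L * η * b * (a * U) := by ring
    _ ≤ L * η * b * D := mul_le_mul_of_nonneg_left hl (by positivity)
    _ = _ := by ring
  have h₄ : γ₁ * (1 - γ₂) * a ^ 2 / (L * b) * U ≤ γ₁ * (η * D) := by
    rw [div_mul_eq_mul_div, div_le_iff₀ (by positivity)]
    have := mul_le_mul_of_nonneg_left h₃ hγ₁.le
    linarith
  linarith

/-- Quasi-Newton steps contract the optimality gap by a uniform factor. -/
theorem exists_qn_contraction (h : QuadraticBounds f (gradient f) μ L) {C : Set (E n)}
    (hC : IsPolyhedral C) (P : Params) (Φ : FaceBasis n) :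
    ∃ q < 1, ∀ x : ℕ → E n, (∀ t, x t ∈ C) → ∀ t, IsQNStep P Φ f C x t →
      ∀ y ∈ C, f (x (t + 1)) - f y ≤ q * (f (x t) - f y) := by
  have hL : 0 < L := h.pos.trans_le h.le
  have hμ := h.pos
  obtain ⟨a, b, ha, hb, hab⟩ := exists_matrixBounds_lbfgsMatrix (L := L) P.h₀_pos h.pos P.N
  have hγ₁ := P.γ₁_pos
  have hγ₂ : 0 < 1 - P.γ₂ := sub_pos.2 P.γ₂_lt_one
  set c := P.γ₁ * (1 - P.γ₂) * a ^ 2 / (L * b)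
  have hc : 0 < c := by positivity
  -- The decrease is at least `c ‖p‖²` and the gap at most `‖p‖² / (2 μ)`, with `p` the gradient
  -- projected onto the face.
  refine ⟨1 - 2 * μ * c, by linarith [show 0 < 2 * μ * c by positivity], ?_⟩
  intro x hx t hqn y hy
  obtain ⟨pairs, hmodel, η, hη, -, hw₁, hw₂, hstep⟩ := hqn
  obtain ⟨hlen, hcone, hpairs⟩ := model_eq_some hC hx hmodel
  have hH : MatrixBounds a b (faceMatrix Φ P.h₀ (faceAt C (x t)) pairs) := by
    refine hab _ _ (by simpa using hlen) fun p hp => ?_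
    obtain ⟨p', hp', rfl⟩ := List.mem_map.1 hp
    obtain ⟨hspan, u, v, hu, hv⟩ := hpairs p' hp'
    rw [hu] at hspan ⊢
    rw [hv]
    exact h.isCurvaturePair Φ _ hspan
  have h₁ := h.wolfe_decrease Φ _ ha hb hγ₁ P.γ₂_lt_one hη hH (qnDirection_eq Φ _ _ _ _) hw₁ hw₂
  rw [← hstep] at h₁
  have h₂ := h.sub_le_of_inner_le (inner_faceVec_le_of_neg_mem_selfProjCone hC Φ (hx t) hcone hy)
  rw [norm_faceVec_sq, le_div_iff₀ (by positivity)] at h₂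
  have h₃ := mul_le_mul_of_nonneg_left h₂ hc.le
  linarith

/-! ### Projected-gradient steps -/

theorem mul_inner_proj_sub_le {C : Set (E n)} (hC : IsPolyhedral C) {x g : E n} (hx : x ∈ C)
    (α : ℝ) :
    α * inner ℝ g (proj C (x - α • g) - x) ≤ -‖proj C (x - α • g) - x‖ ^ 2 := by
  have h := (proj_spec hC ⟨x, hx⟩ (x - α • g)).inner_le_zero hC.convex hx
  set z := proj C (x - α • g)
  have h₁ : x - α • g - z = -(z - x) - α • g := by abel
  rw [h₁, ← neg_sub z x, inner_neg_right, inner_sub_left, inner_neg_left,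
    real_inner_self_eq_norm_sq, real_inner_smul_left] at h
  linarith

/-- The quadratic upper bound with `‖z - x‖² ≤ -α p`. Short steps always pass, so backtracking
cannot go far below `2 (1 - γ) / L`. -/
theorem armijo_of_le (h : QuadraticBounds f G μ L) {C : Set (E n)} (hC : IsPolyhedral C)
    {γ α : ℝ} (hα : 0 < α) (hαγ : L * α ≤ 2 * (1 - γ)) {x : E n} (hx : x ∈ C) :
    f (proj C (x - α • G x)) ≤ f x + γ * inner ℝ (G x) (proj C (x - α • G x) - x) := by
  have h₁ := mul_inner_proj_sub_le hC (g := G x) hx α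
  have h₂ := h.upper x (proj C (x - α • G x))
  set z := proj C (x - α • G x)
  set p := inner ℝ (G x) (z - x)
  have hL : 0 < L := h.pos.trans_le h.le
  have hp : p ≤ 0 := by
    have : α * p ≤ 0 := h₁.trans (neg_nonpos.2 (by positivity))
    exact nonpos_of_mul_nonpos_right this hα
  have h₃ := mul_le_mul_of_nonneg_left h₁ hL.le
  have h₄ := mul_le_mul_of_nonpos_right hαγ hp
  linarith

/-- `p - G z` is `1 / α` times the projection residual, hence normal to `C` at `z`, so `p` is
admissible in `sub_le_of_inner_le` at `z`; and `‖p‖` is at most a multiple of `‖z - x‖`. -/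
theorem proj_sub_le (h : QuadraticBounds f G μ L) {C : Set (E n)} (hC : IsPolyhedral C)
    {α α₁ : ℝ} (hα₁ : 0 < α₁) (hα : α₁ ≤ α) {x y : E n} (hx : x ∈ C) (hy : y ∈ C) :
    f (proj C (x - α • G x)) - f y ≤
      (1 / α₁ + L) ^ 2 / (2 * μ) * ‖proj C (x - α • G x) - x‖ ^ 2 := by
  have hμ := h.pos
  have hα0 : 0 < α := hα₁.trans_le hα
  have hproj := (proj_spec hC ⟨x, hx⟩ (x - α • G x)).inner_le_zero hC.convex hy
  set z := proj C (x - α • G x)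
  set p : E n := (1 / α) • (x - z) + (G z - G x) with hp
  have hpα : p - G z = (1 / α) • (x - α • G x - z) := by
    rw [hp, smul_sub, smul_sub, smul_sub, smul_smul, one_div, inv_mul_cancel₀ hα0.ne', one_smul]
    abel
  have h₁ : inner ℝ p (y - z) ≤ inner ℝ (G z) (y - z) := by
    rw [← sub_nonpos, ← inner_sub_left, hpα, real_inner_smul_left]
    exact mul_nonpos_of_nonneg_of_nonpos (by positivity) hproj
  have h₂ : ‖p‖ ≤ (1 / α₁ + L) * ‖z - x‖ := calc
    ‖p‖ ≤ ‖(1 / α) • (x - z)‖ + ‖G z - G x‖ := norm_add_le _ _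
    _ ≤ 1 / α * ‖z - x‖ + L * ‖z - x‖ := by
      rw [norm_smul, Real.norm_of_nonneg (by positivity), norm_sub_rev]
      exact add_le_add le_rfl (h.lipschitz x z)
    _ ≤ 1 / α₁ * ‖z - x‖ + L * ‖z - x‖ := by gcongr
    _ = _ := by ring
  calc f z - f y ≤ ‖p‖ ^ 2 / (2 * μ) := h.sub_le_of_inner_le h₁
    _ ≤ ((1 / α₁ + L) * ‖z - x‖) ^ 2 / (2 * μ) := by gcongr
    _ = _ := by ring

end QuadraticBounds

theorem bbStep_mem_Icc {n : ℕ} (P : Params) (f : E n → ℝ) {α₀ : ℝ}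
    (hα₀ : α₀ ∈ Set.Icc P.αmin P.αmax) (x : ℕ → E n) (t : ℕ) :
    bbStep P f α₀ x t ∈ Set.Icc P.αmin P.αmax := by
  have := P.αmin_lt_αmax.le
  cases t with
  | zero => exact hα₀
  | succ t =>
    simp only [bbStep]
    split_ifs
    · exact ⟨le_max_right _ _, max_le (min_le_right _ _) this⟩
    · exact ⟨this, le_rfl⟩

/-! ### The nonmonotone history and contraction of its maximum. -/

section History

variable {n : ℕ} {P : Params} {f : E n → ℝ} {x : ℕ → E n} {qn : ℕ → Prop}

theorem le_historyMax {t j : ℕ} (hj : j ≤ t - historyStart qn t) (hjM : j ≤ P.M - 1) :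
    f (x (t - j)) ≤ historyMax P f x qn t :=
  Finset.le_sup' (fun j => f (x (t - j))) (Finset.mem_range.2 (by omega))

theorem historyMax_le_iff {t : ℕ} {c : ℝ} : historyMax P f x qn t ≤ c ↔
    ∀ j, j ≤ t - historyStart qn t → j ≤ P.M - 1 → f (x (t - j)) ≤ c := by
  rw [historyMax, Finset.sup'_le_iff]
  exact ⟨fun h j h₁ h₂ => h j (Finset.mem_range.2 (by omega)), fun h j hj =>
    h j (by have := Finset.mem_range.1 hj; omega) (by have := Finset.mem_range.1 hj; omega)⟩

theorem self_le_historyMax (t : ℕ) : f (x t) ≤ historyMax P f x qn t :=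
  le_historyMax (j := 0) (Nat.zero_le _) (Nat.zero_le _)

theorem historyMax_antitone (h : ∀ t, f (x (t + 1)) ≤ historyMax P f x qn t) :
    Antitone (historyMax P f x qn) := by
  refine antitone_nat_of_succ_le fun t => historyMax_le_iff.2 fun j hj hjM => ?_
  cases j with
  | zero => exact h t
  | succ j =>
    rw [Nat.add_sub_add_right]
    refine le_historyMax ?_ (by omega)
    rw [historyStart] at hj
    -- After a reset the window is just the new value, so `j + 1` is impossible; otherwise the index
    -- shifts by one.
    split_ifs at hj <;> omega

/-- Every value in the window at `t + M` was produced by a step from some `i ≥ t`, so `W (t + M) - m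
≤ q (W t - m)`. In the limit `l - m ≤ q (l - m)`, which forces `l = m`. -/
theorem tendsto_of_historyMax_contraction {q m : ℝ} (hq₀ : 0 ≤ q) (hq : q < 1)
    (hm : ∀ t, m ≤ f (x t))
    (h : ∀ t, f (x (t + 1)) - m ≤ q * (historyMax P f x qn t - m)) :
    Filter.Tendsto (fun t => f (x t)) Filter.atTop (nhds m) := by
  have hW : ∀ t, m ≤ historyMax P f x qn t := fun t => (hm t).trans (self_le_historyMax t)
  have hanti : Antitone (historyMax P f x qn) := historyMax_antitone fun t => by
    nlinarith [h t, hW t]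
  have hlim := tendsto_atTop_ciInf hanti ⟨m, by rintro _ ⟨t, rfl⟩; exact hW t⟩
  set l := ⨅ t, historyMax P f x qn t
  have hstep : ∀ t, historyMax P f x qn (t + P.M) ≤ m + q * (historyMax P f x qn t - m) := by
    refine fun t => historyMax_le_iff.2 fun j _ hjM => ?_
    have hM := P.one_le_M
    obtain ⟨i, hi⟩ : ∃ i, t + P.M - j = i + 1 := ⟨t + P.M - j - 1, by omega⟩
    rw [hi]
    have h₁ := mul_le_mul_of_nonneg_left (hanti (show t ≤ i by omega)) hq₀
    linarith [h i]
  have hl : l ≤ m + q * (l - m) := le_of_tendsto_of_tendsto'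
    ((Filter.tendsto_add_atTop_iff_nat P.M).2 hlim) (((hlim.sub_const m).const_mul q).const_add m)
    hstep
  have hml : m ≤ l := le_ciInf hW
  have hlm : l = m := by nlinarith
  rw [hlm] at hlim
  exact tendsto_of_tendsto_of_tendsto_of_le_of_le tendsto_const_nhds hlim hm self_le_historyMax

end History

/-- Projected-gradient steps contract the optimality gap, measured from the maximum of the stored
objective values, by a uniform factor. -/
theorem QuadraticBounds.exists_spg_contraction {n : ℕ} {f : E n → ℝ} {μ L : ℝ}
    (h : QuadraticBounds f (gradient f) μ L) {C : Set (E n)} (hC : IsPolyhedral C) (P : Params) :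
    ∃ q, 0 ≤ q ∧ q < 1 ∧ ∀ α₀ ∈ Set.Icc P.αmin P.αmax, ∀ (x : ℕ → E n) (qn : ℕ → Prop) (t : ℕ),
      x t ∈ C → IsSPGStep P f C α₀ x qn t →
        ∀ y ∈ C, f (x (t + 1)) - f y ≤ q * (historyMax P f x qn t - f y) := by
  have hL : 0 < L := h.pos.trans_le h.le
  have hμ := h.pos
  obtain ⟨hβ₀, hβ₁⟩ := P.β_mem
  obtain ⟨hγ₀, hγ₁⟩ := P.γ_mem
  have hαmax : 0 < P.αmax := P.αmin_pos.trans P.αmin_lt_αmax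
  have hγ : 0 < 1 - P.γ := by linarith
  -- Either the first trial, at least `αmin`, is accepted, or the last rejected trial exceeded `2 (1
  -- - γ) / L` and was multiplied by `β`.
  set α₁ := min P.αmin (P.β * (2 * (1 - P.γ) / L)) with hα₁
  have hα₁0 : 0 < α₁ := lt_min P.αmin_pos (by positivity)
  set K := (1 / α₁ + L) ^ 2 / (2 * μ)
  have hK : 0 < K := by positivity
  set c := P.γ / P.αmax with hc
  have hc0 : 0 < c := by positivity
  -- With `s = ‖x (t+1) - x t‖²`, the new gap is at most `K s` and `c s ≤ W t - f (x (t+1))`;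
  -- eliminating `s` gives this ratio.
  refine ⟨K / (K + c), by positivity, (div_lt_one (by positivity)).2 (by linarith), ?_⟩
  rintro α₀ hα₀ x qn t hx ⟨k, hk, hmin, hstep⟩ y hy
  obtain ⟨hbb₁, hbb₂⟩ := bbStep_mem_Icc P f hα₀ x t
  have hbb : 0 < bbStep P f α₀ x t := P.αmin_pos.trans_le hbb₁
  have hlow : α₁ ≤ P.β ^ k * bbStep P f α₀ x t := by
    cases k with
    | zero =>
      rw [pow_zero, one_mul]
      exact (min_le_left _ _).trans hbb₁
    | succ k =>
      refine (min_le_right _ _).trans ?_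
      rw [pow_succ', mul_assoc]
      refine mul_le_mul_of_nonneg_left ?_ hβ₀.le
      by_contra! hlt
      refine hmin k (Nat.lt_succ_self k) ?_
      have h₁ := h.armijo_of_le hC (γ := P.γ) (α := P.β ^ k * bbStep P f α₀ x t) (by positivity)
        (by rw [lt_div_iff₀ hL] at hlt; linarith) hx
      exact h₁.trans (add_le_add (self_le_historyMax t) le_rfl)
  have hhigh : P.β ^ k * bbStep P f α₀ x t ≤ P.αmax :=
    (mul_le_of_le_one_left hbb.le (pow_le_one₀ hβ₀.le hβ₁.le)).trans hbb₂
  set α := P.β ^ k * bbStep P f α₀ x t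
  have h₁ := h.proj_sub_le hC hα₁0 hlow hx hy
  have h₂ := QuadraticBounds.mul_inner_proj_sub_le hC (g := gradient f (x t)) hx α
  change f (proj C (x t - α • gradient f (x t))) ≤ historyMax P f x qn t + P.γ *
    inner ℝ (gradient f (x t)) (proj C (x t - α • gradient f (x t)) - x t) at hk
  rw [← hstep] at h₁ h₂ hk
  set p := inner ℝ (gradient f (x t)) (x (t + 1) - x t)
  set s := ‖x (t + 1) - x t‖ ^ 2
  have hα0 : 0 < α := hα₁0.trans_le hlow
  have hp : p ≤ 0 := by
    have : α * p ≤ 0 := h₂.trans (neg_nonpos.2 (by positivity))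
    exact nonpos_of_mul_nonpos_right this hα0
  have h₃ : c * s ≤ -(P.γ * p) := by
    rw [hc, div_mul_eq_mul_div, div_le_iff₀ hαmax]
    have h₄ := mul_le_mul_of_nonpos_right hhigh hp
    have h₅ := mul_le_mul_of_nonneg_left (show s ≤ -(P.αmax * p) by linarith) hγ₀.le
    linarith
  rw [div_mul_eq_mul_div, le_div_iff₀ (by positivity)]
  have h₄ := mul_le_mul_of_nonneg_left h₁ hc0.le
  have h₅ := mul_le_mul_of_nonneg_left h₃ hK.le
  have h₆ := mul_le_mul_of_nonneg_left hk hK.le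
  linarith

/-! ### Feasibility and convergence of the generated sequence. -/

theorem IsGenerated.mem {n : ℕ} {P : Params} {Φ : FaceBasis n} {f : E n → ℝ} {C : Set (E n)}
    (hC : IsPolyhedral C) {x₀ : E n} (hx₀ : x₀ ∈ C) {x : ℕ → E n}
    (hx : IsGenerated P Φ f C x₀ x) (t : ℕ) : x t ∈ C := by
  obtain ⟨α₀, qn, -, h0, hstep⟩ := hx
  induction t with
  | zero => rwa [h0]
  | succ t ih =>
    by_cases hq : qn t
    · obtain ⟨pairs, -, η, -, hmem, -, -, hx⟩ := (hstep t).1 hq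
      rw [hx]
      exact (faceAt_spec hC ih).1.2.subset hmem
    · obtain ⟨k, -, -, hx⟩ := (hstep t).2 hq
      rw [hx]
      exact (proj_spec hC ⟨x₀, hx₀⟩ _).1

theorem IsGenerated.tendsto_value {n : ℕ} {P : Params} {Φ : FaceBasis n} {f : E n → ℝ} {μ L : ℝ}
    (h : QuadraticBounds f (gradient f) μ L) {C : Set (E n)} (hC : IsPolyhedral C) {x₀ : E n}
    (hx₀ : x₀ ∈ C) {x : ℕ → E n} (hx : IsGenerated P Φ f C x₀ x) {xs : E n} (hxs : xs ∈ C)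
    (hmin : IsMinOn f C xs) :
    Filter.Tendsto (fun t => f (x t)) Filter.atTop (nhds (f xs)) := by
  have hmem := hx.mem hC hx₀
  obtain ⟨α₀, qn, hα₀, -, hstep⟩ := hx
  obtain ⟨q₁, hq₁, h₁⟩ := h.exists_qn_contraction hC P Φ
  obtain ⟨q₂, hq₂₀, hq₂, h₂⟩ := h.exists_spg_contraction hC P
  have hval : ∀ t, f xs ≤ f (x t) := fun t => hmin (hmem t)
  refine tendsto_of_historyMax_contraction (P := P) (qn := qn) (q := max q₁ q₂)
    (le_max_of_le_right hq₂₀) (max_lt hq₁ hq₂) hval fun t => ?_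
  have hW : f (x t) ≤ historyMax P f x qn t := self_le_historyMax t
  have hgap : 0 ≤ f (x t) - f xs := sub_nonneg.2 (hval t)
  by_cases hq : qn t
  · calc _ ≤ q₁ * (f (x t) - f xs) := h₁ x hmem t ((hstep t).1 hq) xs hxs
      _ ≤ max q₁ q₂ * (f (x t) - f xs) := mul_le_mul_of_nonneg_right (le_max_left _ _) hgap
      _ ≤ _ := mul_le_mul_of_nonneg_left (by linarith) (le_max_of_le_right hq₂₀)
  · exact (h₂ α₀ hα₀ x qn t (hmem t) ((hstep t).2 hq) xs hxs).trans
      (mul_le_mul_of_nonneg_right (le_max_right _ _) (by linarith))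

end HybridSPG

theorem mainTheorem1 (n : ℕ) (C : Set (HybridSPG.E n)) (hC : HybridSPG.IsPolyhedral C)
    (f : HybridSPG.E n → ℝ) (hf : HybridSPG.Assumptions f)
    (P : HybridSPG.Params) (Φ : HybridSPG.FaceBasis n)
    (x₀ : HybridSPG.E n) (hx₀ : x₀ ∈ C)
    (x : ℕ → HybridSPG.E n) (hx : HybridSPG.IsGenerated P Φ f C x₀ x) :
    ∃ xs : HybridSPG.E n, (xs ∈ C ∧ IsMinOn f C xs) ∧
      (∀ y : HybridSPG.E n, y ∈ C → IsMinOn f C y → y = xs) ∧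
      Filter.Tendsto x Filter.atTop (nhds xs) := by
  obtain ⟨μ, L, h⟩ := hf.exists_quadraticBounds
  have hμ := h.pos
  obtain ⟨xs, hxs, hmin⟩ := h.exists_isMinOn hC.isClosed hx₀
  -- Quadratic growth yields both uniqueness and convergence of the iterates.
  have hbound : ∀ y ∈ C, ‖y - xs‖ ^ 2 ≤ 2 / μ * (f y - f xs) := fun y hy => by
    have := h.le_of_isMinOn hC.convex hxs hmin hy
    rw [div_mul_eq_mul_div, le_div_iff₀ hμ]
    linarith
  refine ⟨xs, ⟨hxs, hmin⟩, fun y hy hymin => ?_, ?_⟩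
  · have h₁ := hbound y hy
    rw [show f y = f xs from le_antisymm (hymin hxs) (hmin hy), sub_self, mul_zero] at h₁
    exact sub_eq_zero.1 (norm_eq_zero.1 (pow_eq_zero_iff two_ne_zero |>.1
      (le_antisymm h₁ (by positivity))))
  · have hlim := ((hx.tendsto_value h hC hx₀ hxs hmin).sub_const (f xs)).const_mul (2 / μ)
    rw [sub_self, mul_zero] at hlim
    have hsq : Filter.Tendsto (fun t => ‖x t - xs‖ ^ 2) Filter.atTop (nhds 0) :=
      squeeze_zero (fun t => by positivity) (fun t => hbound _ (hx.mem hC hx₀ t)) hlim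
    rw [tendsto_iff_norm_sub_tendsto_zero]
    simpa [Function.comp_def, Real.sqrt_sq] using (Real.continuous_sqrt.tendsto 0).comp hsq
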